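/- Let $\mathcal G=(\mathcal S,\mathcal E)$ be a finite directed graph, possibly with cycles, with an initial state $s_0$ that has no incoming edges and a sink $s_f\neq s_0$ that has no outgoing edges, such that for every state $s$ there are a path from $s_0$ to $s$ and a path from $s$ to $s_f$. Let $\mathcal X=\{x: x\to s_f\in\mathcal E\}$, let $\mathcal R(x)>0$ for $x\in\mathcal X$, and $\mathcal Z=\sum_{x\in\mathcal X}\mathcal R(x)$. A trajectory from $u$ is a finite path $\tau=(u=z_0\to z_1\to\dots\to z_{n_\tau}\to z_{n_\tau+1}=s_f)$ in $\mathcal G$, and $\mathcal T$ is the set of trajectories from the initial state. A forward policy $P_F(\cdot\mid s)$ is a probability distribution over the children of $s$ for each $s\ne s_f$; a backward policy $P_B(\cdot\mid s')$ is a probability distribution over the parents of $s'$ for each $s'\neq s_0$. Fix a backward policy with $P_B(s\mid s')>0$ for every edge $s\to s'$, and put $\mathcal P(\tau)=\prod_{t=0}^{n_\tau}P_B(z_t\mid z_{t+1})$ for $\tau\in\mathcal T$. Assume reward matching: $\sum_{\tau\in\mathcal T,\ z_{n_\tau}=x}\mathcal P(\tau)=\mathcal R(x)/\mathcal Z$ for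 all $x\in\mathcal X$. Define the flows $$\mathcal F(s)=\mathcal Z\sum_{\tau\in\mathcal T}\mathcal P(\tau)\,\#\{0\le t\le n_\tau+1: z_t=s\},\qquad \mathcal F(s\to s')=\mathcal Z\sum_{\tau\in\mathcal T}\mathcal P(\tau)\,\#\{0\le t\le n_\tau: z_t=s,\ z_{t+1}=s'\}.$$ Consider the undiscounted deterministic MDP with state space $\mathcal S$ in which the actions at $s$ are the children of $s$, choosing $s'$ moves to $s'$, and the rewards are $r(x,s_f)=\log\mathcal R(x)$ on terminating edges and $r(s,s')=\log P_B(s\mid s')$ on all other edges. Its policies $\pi$ are the forward policies. With $\mathcal H$ the Shannon entropy and $(z_t)$ the chain that starts at $u$, follows $\pi$ and stays in $s_f$ once it gets there, the regularized value with coefficient $\lambda$ is $$V^\pi_\lambda(u)=\limsup_{N\to\infty}\ \mathbb E_\pi\Big[\sum_{0\le t<N,\ z_t\ne s_f} \big(r(z_t,z_{t+1})+\lambda\mathcal H(\pi(\cdot\mid z_t))\big)\,\Big|\, z_0=u\Big]\in[-\infty,\infty],$$ so $V^\pi_\lambda(s_f)=0$. Put $Q^\pi_\lambda(s,s')=r(s,s')+V^\pi_\lambda(s')$,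 $V^\star_\lambda(s)=\sup_\pi V^\pi_\lambda(s)$ and $Q^\star_\lambda(s,s')=r(s,s')+V^\star_\lambda(s')$. A policy is optimal if it maximizes $V^\pi_\lambda(s_0)$ at the initial state $s_0$ among all policies. Then there is a unique forward policy $P_F$ with $\prod_{t=0}^{n_\tau}P_F(z_{t+1}\mid z_t)=\mathcal P(\tau)$ for all $\tau\in\mathcal T$, and for $\lambda=1$: 1. $P_F$ is optimal, and it is the only optimal policy. 2. From every $s\ne s_f$ the chain that follows $P_F$ reaches $s_f$ almost surely, and the expectation $\mathbb E_{P_F}\big[\sum_{t=0}^{n_\tau}\big(r(z_t,z_{t+1})+\mathcal H(P_F(\cdot\mid z_t))\big)\,\big|\,z_0=s\big]$ over its trajectories converges absolutely and equals $\log\mathcal F(s)$. 3. $V^\star_1(s)=V^{P_F}_1(s)=\log\mathcal F(s)$ for every $s\ne s_f$. 4. $Q^\star_1(s,s')=Q^{P_F}_1(s,s')=\log\mathcal F(s\to s')$ for every edge $s\to s'\in\mathcal E$. -/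

import Mathlib

open scoped ENNReal

/-- A finite directed graph, possibly with cycles and self-loops, with an initial state without
incoming edges and a sink without outgoing edges, in which every state lies on a path from the
initial state to the sink. -/
structure FlowGraph (S : Type*) [Fintype S] where
  Adj : S → S → Prop
  init : S
  sink : S
  init_ne_sink : init ≠ sink
  not_adj_init : ∀ s, ¬ Adj s init
  not_sink_adj : ∀ s, ¬ Adj sink s
  reach_from_init : ∀ s, Relation.ReflTransGen Adj init s
  reach_to_sink : ∀ s, Relation.ReflTransGen Adj s sink

namespace FlowGraph

variable {S : Type*} [Fintype S] (G : FlowGraph S)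

lemma ne_sink_of_adj {s s' : S} (h : G.Adj s s') : s ≠ G.sink := by
  rintro rfl
  exact G.not_sink_adj _ h

lemma ne_init_of_adj {s s' : S} (h : G.Adj s s') : s' ≠ G.init := by
  rintro rfl
  exact G.not_adj_init _ h

/-- A forward policy: for each state other than the sink, a probability distribution over its
children. In the deterministic MDP induced by the graph, where the actions at `s` are the children
of `s` and choosing a child moves there with probability one, this is also exactly a policy. -/
def ForwardPolicy : Type _ :=
  (s : {s : S // s ≠ G.sink}) → PMF {s' : S // G.Adj s.1 s'}

/-- A backward policy: for each state other than the initial one, a probability distribution over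
its parents. -/
def BackwardPolicy : Type _ :=
  (s' : {s' : S // s' ≠ G.init}) → PMF {s : S // G.Adj s s'.1}

/-- A finite trajectory `u = s_0 → s_1 → ⋯ → s_n → s_{n+1} = s_f` of length `n = len` from `u` to
the sink. -/
structure Traj (u : S) where
  len : ℕ
  state : Fin (len + 2) → S
  start_eq : state 0 = u
  last_eq : state (Fin.last (len + 1)) = G.sink
  adj : ∀ t : Fin (len + 1), G.Adj (state t.castSucc) (state t.succ)

variable {G}

open scoped Classical in
/-- `π.prob s s'` is `π(s' ∣ s)`. -/
noncomputable def ForwardPolicy.prob (π : G.ForwardPolicy) (s s' : S) : ℝ≥0∞ :=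
  if h : G.Adj s s' then π ⟨s, G.ne_sink_of_adj h⟩ ⟨s', h⟩ else 0

open scoped Classical in
/-- `PB.prob s s'` is `P_B(s ∣ s')`, the probability of the parent `s` at the state `s'`. -/
noncomputable def BackwardPolicy.prob (PB : G.BackwardPolicy) (s s' : S) : ℝ≥0∞ :=
  if h : G.Adj s s' then PB ⟨s', G.ne_init_of_adj h⟩ ⟨s, h⟩ else 0

/-- The probability `∏_{t=0}^{n} π(s_{t+1} ∣ s_t)` of a trajectory under a forward policy. -/
noncomputable def ForwardPolicy.trajProb (π : G.ForwardPolicy) {u : S} (τ : G.Traj u) : ℝ≥0∞ :=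
  ∏ t : Fin (τ.len + 1), π.prob (τ.state t.castSucc) (τ.state t.succ)

/-- The probability `∏_{t=0}^{n} P_B(s_t ∣ s_{t+1})` of a trajectory under a backward policy. -/
noncomputable def BackwardPolicy.trajProb (PB : G.BackwardPolicy) {u : S} (τ : G.Traj u) : ℝ≥0∞ :=
  ∏ t : Fin (τ.len + 1), PB.prob (τ.state t.castSucc) (τ.state t.succ)

/-- A forward and a backward policy induce the same distribution over the trajectories from the
initial state to the sink. -/
def Corresponds (PF : G.ForwardPolicy) (PB : G.BackwardPolicy) : Prop :=
  ∀ τ : G.Traj G.init, PF.trajProb τ = PB.trajProb τ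

variable (G) in
open scoped Classical in
/-- The normalizing constant: the sum of the rewards of all terminal states. -/
noncomputable def totalReward (R : S → ℝ) : ℝ :=
  ∑ x : S, if G.Adj x G.sink then R x else 0

/-- The terminal state `s_n` in which a trajectory terminates. -/
def Traj.terminal {u : S} (τ : G.Traj u) : S :=
  τ.state (Fin.last τ.len).castSucc

open scoped Classical in
/-- Reward matching: a trajectory drawn from the distribution induced by `PB` terminates in `x`
with probability `R x / Z`, for every terminal state `x`. -/
def BackwardPolicy.RewardMatching (PB : G.BackwardPolicy) (R : S → ℝ) : Prop :=
  ∀ x : S, G.Adj x G.sink →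
    (∑' τ : G.Traj G.init, if τ.terminal = x then PB.trajProb τ else 0)
      = ENNReal.ofReal (R x / G.totalReward R)

open scoped Classical in
/-- The state flow induced by `PB` and the final flow `Ff`: `Ff` times the expected number of
visits to `s`. -/
noncomputable def BackwardPolicy.stateFlow (PB : G.BackwardPolicy) (Ff : ℝ≥0∞) (s : S) : ℝ≥0∞ :=
  Ff * ∑' τ : G.Traj G.init,
    PB.trajProb τ * ∑ t : Fin (τ.len + 2), if τ.state t = s then 1 else 0

open scoped Classical in
/-- The edge flow induced by `PB` and the final flow `Ff`: `Ff` times the expected number of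
passages through `s → s'`. -/
noncomputable def BackwardPolicy.edgeFlow (PB : G.BackwardPolicy) (Ff : ℝ≥0∞) (s s' : S) : ℝ≥0∞ :=
  Ff * ∑' τ : G.Traj G.init,
    PB.trajProb τ *
      ∑ t : Fin (τ.len + 1), if τ.state t.castSucc = s ∧ τ.state t.succ = s' then 1 else 0

open scoped Classical in
/-- The rewards of the MDP induced by the graph: `log R(x)` on a terminating edge `x → s_f` and
`log P_B(s ∣ s')` on every other edge `s → s'`. -/
noncomputable def mdpReward (PB : G.BackwardPolicy) (R : S → ℝ) (s s' : S) : ℝ :=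
  if s' = G.sink then Real.log (R s) else Real.log (PB.prob s s').toReal

/-- Shannon entropy of `π(· ∣ s)`. -/
noncomputable def ForwardPolicy.entropy (π : G.ForwardPolicy) (s : S) : ℝ :=
  ∑ s' : S, Real.negMulLog (π.prob s s').toReal

/-- The entropy-regularized return `∑_{t=0}^{n} (r(s_t, s_{t+1}) + λ H(π(· ∣ s_t)))` of a
trajectory. -/
noncomputable def ForwardPolicy.trajReturn (π : G.ForwardPolicy) (r : S → S → ℝ) (lam : ℝ) {u : S}
    (τ : G.Traj u) : ℝ :=
  ∑ t : Fin (τ.len + 1),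
    (r (τ.state t.castSucc) (τ.state t.succ) + lam * π.entropy (τ.state t.castSucc))

open scoped Classical in
/-- Transition probabilities of the Markov chain that follows `π` until it reaches the sink, where
it stays. -/
noncomputable def ForwardPolicy.kernel (π : G.ForwardPolicy) (s s' : S) : ℝ≥0∞ :=
  if s = G.sink then (if s' = G.sink then 1 else 0) else π.prob s s'

open scoped Classical in
/-- The expected entropy-regularized return collected from `u` during the first `N` steps, before
the sink is reached: the expectation over the first `N` transitions `x 0 → ⋯ → x N` of the chain
that follows `π` from `u`. -/
noncomputable def ForwardPolicy.expectedReturn (π : G.ForwardPolicy) (r : S → S → ℝ) (lam : ℝ)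
    (N : ℕ) (u : S) : ℝ :=
  ∑ x : Fin (N + 1) → S,
    if x 0 = u then
      (∏ t : Fin N, π.kernel (x t.castSucc) (x t.succ)).toReal *
        ∑ t : Fin N,
          if x t.castSucc = G.sink then 0
          else r (x t.castSucc) (x t.succ) + lam * π.entropy (x t.castSucc)
    else 0

/-- The undiscounted regularized value `V^π_λ(u)`: the limit (superior) of the expected returns
over growing horizons. A policy need not reach the sink almost surely, so the value lives in the
extended reals; at the sink it is `0`. -/
noncomputable def ForwardPolicy.value (π : G.ForwardPolicy) (r : S → S → ℝ) (lam : ℝ) (u : S) :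
    EReal :=
  Filter.limsup (fun N : ℕ => (π.expectedReturn r lam N u : EReal)) Filter.atTop

/-- The regularized Q-value `Q^π_λ(s, s') = r(s, s') + V^π_λ(s')`. -/
noncomputable def ForwardPolicy.qValue (π : G.ForwardPolicy) (r : S → S → ℝ) (lam : ℝ)
    (s s' : S) : EReal :=
  (r s s' : EReal) + π.value r lam s'

/-- A policy is optimal if it maximizes the regularized value at the initial state among all
policies. -/
def ForwardPolicy.IsOptimal (π : G.ForwardPolicy) (r : S → S → ℝ) (lam : ℝ) : Prop :=
  ∀ π' : G.ForwardPolicy, π'.value r lam G.init ≤ π.value r lam G.init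

variable (G) in
/-- The optimal regularized value `V*_λ(u)`: the supremum of the values over all policies. -/
noncomputable def optValue (r : S → S → ℝ) (lam : ℝ) (u : S) : EReal :=
  ⨆ π : G.ForwardPolicy, π.value r lam u

variable (G) in
/-- The optimal regularized Q-value `Q*_λ(s, s') = r(s, s') + V*_λ(s')`. -/
noncomputable def optQValue (r : S → S → ℝ) (lam : ℝ) (s s' : S) : EReal :=
  (r s s' : EReal) + G.optValue r lam s'

end FlowGraph

/-! Let w(s) (`visits`) be the total P_B-weight of the paths from s to the sink. It is harmonic away
from the sink, w(s) = Σ P_B(s ∣ s') w(s'), and w(s_0) = w(s_f) = 1. The backward chain hits s_0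
almost surely from every state, so 𝓕(s → s') = 𝒵 P_B(s ∣ s') w(s') and 𝓕(s) = 𝒵 w(s). Hence P_F is
the Doob transform P_B(s ∣ s') w(s') / w(s), whose products along trajectories telescope to 𝓟(τ).
Uniqueness follows by comparing expected edge passages (`eq_forward_of_corresponds`).

Reward matching says P_B(x ∣ s_f) = R(x)/𝒵. So with φ = log 𝓕 off the sink and φ(s_f) = 0, every
reward equals φ(s) + log P_F(s' ∣ s) - φ(s') (`mdpReward_eq`). For any policy π the expected
regularized reward of one step is then φ(s) - E φ(z_1) - KL(π ‖ P_F) (`step_eq`), and the return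
over N steps is φ(u) - E φ(z_N) minus the accumulated KL gaps.

The difficulty is that π may fail to reach the sink. Where the gap vanishes, π agrees with P_F and
drifts to the sink (`exists_drift`). A finite total gap therefore forces a finite expected time
outside the sink, and E φ(z_N) → 0; an infinite total gap gives the value -∞, since φ is bounded
(`limsup_potential_sub_gap`). So the value is φ minus the total gap, with equality to φ for P_F.
Optimality at s_0 kills the gap at every visited state, and positivity of P_F on all edges makes
every state visited. -/

open scoped ENNReal

/-! ### Lyapunov functions on finite chains -/

open Filter Topology in
/-- On a finite set a chain that can reach the target from everywhere has a Lyapunov function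
whose expected decrease outside of the target is at least one. -/
theorem exists_lyapunov {S : Type*} [Fintype S] (P : S → S → ℝ) (o : S)
    (hP : ∀ x y, 0 ≤ P x y) (hsum : ∀ x, x ≠ o → ∑ y, P x y = 1)
    (hreach : ∀ x, Relation.ReflTransGen (fun a b => 0 < P a b) x o) :
    ∃ h : S → ℝ, (∀ x, 0 ≤ h x) ∧ ∀ x, x ≠ o → 1 + ∑ y, P x y * h y ≤ h x := by
  obtain ⟨d, hd⟩ : ∃ d : S → ℕ, ∀ x, x ≠ o → ∃ y, 0 < P x y ∧ d x = d y + 1 := by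
    let reach : ℕ → S → Prop := fun n =>
      Nat.rec (fun x => x = o) (fun _ r x => ∃ y, 0 < P x y ∧ r y) n
    have hex : ∀ x, {n | reach n x}.Nonempty := by
      intro x
      induction hreach x using Relation.ReflTransGen.head_induction_on with
      | refl => exact ⟨0, rfl⟩
      | head hab _ ih =>
        obtain ⟨n, hn⟩ := ih
        exact ⟨n + 1, _, hab, hn⟩
    refine ⟨fun x => sInf {n | reach n x}, fun x hx => ?_⟩
    have h : reach (sInf {n | reach n x}) x := Nat.sInf_mem (hex x)
    rcases hn : sInf {n | reach n x} with _ | n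
    · rw [hn] at h
      exact absurd h hx
    · rw [hn] at h
      obtain ⟨y, hy, hr⟩ := h
      refine ⟨y, hy, ?_⟩
      have h1 : sInf {n | reach n y} ≤ n := Nat.sInf_le hr
      have h2 : sInf {n | reach n x} ≤ sInf {n | reach n y} + 1 :=
        Nat.sInf_le ⟨y, hy, Nat.sInf_mem (hex y)⟩
      show sInf {n | reach n x} = sInf {n | reach n y} + 1
      omega
  -- The factor 2 leaves a surplus of `ε ^ d x` in the final estimate.
  obtain ⟨ε, hε0, hε1, hε⟩ : ∃ ε : ℝ, 0 < ε ∧ ε ≤ 1 ∧ ∀ x y, 0 < P x y → 2 * ε ≤ P x y := by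
    have h1 : ∀ᶠ ε : ℝ in 𝓝[>] 0, ∀ x y, 0 < P x y → 2 * ε ≤ P x y := by
      refine eventually_all.2 fun x => eventually_all.2 fun y => ?_
      by_cases h : 0 < P x y
      · filter_upwards [nhdsWithin_le_nhds (Iic_mem_nhds (half_pos h))] with ε hε _
        have : ε ≤ P x y / 2 := hε
        linarith
      · exact Eventually.of_forall fun _ h' => absurd h' h
    obtain ⟨ε, h, h0, h1⟩ := (h1.and ((eventually_mem_nhdsWithin).and
      (nhdsWithin_le_nhds (Iic_mem_nhds (zero_lt_one' ℝ))))).exists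
    exact ⟨ε, h0, h1, h⟩
  obtain ⟨δ, hδ0, hδ⟩ : ∃ δ : ℝ, 0 < δ ∧ ∀ x, δ ≤ ε ^ d x := by
    have h1 : ∀ᶠ δ : ℝ in 𝓝[>] 0, ∀ x, δ ≤ ε ^ d x :=
      eventually_all.2 fun x => nhdsWithin_le_nhds (Iic_mem_nhds (pow_pos hε0 _))
    obtain ⟨δ, h, h0⟩ := (h1.and eventually_mem_nhdsWithin).exists
    exact ⟨δ, h0, h⟩
  -- A step to a state one closer to `o` has probability at least `2 * ε`, so the mean of `ε ^ d`
  -- after a step from `x` is at least `2 * ε ^ d x`. Dividing by `δ` turns the surplus `ε ^ d x`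
  -- into at least one.
  refine ⟨fun x => (1 - ε ^ d x) / δ, fun x =>
    div_nonneg (sub_nonneg.2 (pow_le_one₀ hε0.le hε1)) hδ0.le, fun x hx => ?_⟩
  obtain ⟨y, hy, hdy⟩ := hd x hx
  have h1 : P x y * ε ^ d y ≤ ∑ z, P x z * ε ^ d z :=
    Finset.single_le_sum (f := fun z => P x z * ε ^ d z)
      (fun z _ => mul_nonneg (hP x z) (pow_nonneg hε0.le _)) (Finset.mem_univ y)
  have h2 : 2 * ε * ε ^ d y ≤ P x y * ε ^ d y :=
    mul_le_mul_of_nonneg_right (hε x y hy) (pow_nonneg hε0.le _)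
  have h3 : ∑ z, P x z * ((1 - ε ^ d z) / δ) = (1 - ∑ z, P x z * ε ^ d z) / δ := by
    conv_rhs => rw [← hsum x hx]
    rw [← Finset.sum_sub_distrib, Finset.sum_div]
    exact Finset.sum_congr rfl fun z _ => by rw [mul_div_assoc', mul_sub, mul_one]
  rw [h3, ← le_sub_iff_add_le, ← sub_div, le_div_iff₀ hδ0]
  have h4 := hδ x
  rw [hdy] at h4 ⊢
  rw [pow_succ] at h4 ⊢
  linarith

/-! ### Hitting probabilities and Green functions of a chain killed at its target -/

section KilledChain

open Matrix Filter Topology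

variable {S : Type*} [Fintype S] [DecidableEq S] (M : Matrix S S ℝ≥0∞) (o : S)

theorem mulVec_one_eq_of_killed (hsum : ∀ x, x ≠ o → ∑ y, M x y = 1) (hkill : ∀ y, M o y = 0) :
    M *ᵥ 1 = fun x => if x = o then 0 else 1 := by
  funext x
  by_cases hx : x = o
  · subst hx
    simp [mulVec, dotProduct, hkill]
  · simp [mulVec, dotProduct, hsum x hx, hx]

/-- Telescoping the Lyapunov inequality bounds the expected time spent outside `o` by the Lyapunov
function at the starting point. -/
theorem tsum_pow_mulVec_ne_top (hsum : ∀ x, x ≠ o → ∑ y, M x y = 1) (hkill : ∀ y, M o y = 0)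
    (hreach : ∀ x, Relation.ReflTransGen (fun a b => M a b ≠ 0) x o) (x : S) :
    ∑' t, (M ^ t *ᵥ (fun x => if x = o then (0 : ℝ≥0∞) else 1)) x ≠ ∞ := by
  have hfin : ∀ x y, M x y ≠ ∞ := by
    intro x y
    by_cases hx : x = o
    · simp [hx, hkill]
    · refine ne_top_of_le_ne_top ENNReal.one_ne_top ?_
      rw [← hsum x hx]
      exact Finset.single_le_sum (f := fun y => M x y) (fun _ _ => zero_le) (Finset.mem_univ y)
  obtain ⟨h, h0, hh⟩ := exists_lyapunov (fun x y => (M x y).toReal) o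
    (fun _ _ => ENNReal.toReal_nonneg)
    (fun x hx => by rw [← ENNReal.toReal_sum fun y _ => hfin x y, hsum x hx, ENNReal.toReal_one])
    (fun x => Relation.ReflTransGen.mono (fun a b hab => ENNReal.toReal_pos hab (hfin a b)) _ _ (hreach x))
  set g : S → ℝ≥0∞ := fun x => ENNReal.ofReal (h x) with hg
  have hstep : (fun x => if x = o then (0 : ℝ≥0∞) else 1) + M *ᵥ g ≤ g := by
    intro x
    by_cases hx : x = o
    · subst hx
      simp [mulVec, dotProduct, hkill]
    · have h1 := ENNReal.ofReal_le_ofReal (hh x hx)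
      rw [ENNReal.ofReal_add zero_le_one
        (Finset.sum_nonneg fun y _ => mul_nonneg ENNReal.toReal_nonneg (h0 y)),
        ENNReal.ofReal_sum_of_nonneg fun y _ => mul_nonneg ENNReal.toReal_nonneg (h0 y)] at h1
      simpa [mulVec, dotProduct, hx, ENNReal.ofReal_mul, ENNReal.ofReal_toReal (hfin _ _)] using h1
  have hmono : ∀ (A : Matrix S S ℝ≥0∞) {u v : S → ℝ≥0∞}, u ≤ v → A *ᵥ u ≤ A *ᵥ v :=
    fun A u v huv x => Finset.sum_le_sum fun y _ => mul_le_mul_right (huv y) _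
  have hpart : ∀ N, (∑ t ∈ Finset.range N,
      M ^ t *ᵥ (fun x => if x = o then (0 : ℝ≥0∞) else 1)) + M ^ N *ᵥ g ≤ g := by
    intro N
    induction N with
    | zero => simp
    | succ N ih =>
      refine le_trans ?_ ih
      rw [Finset.sum_range_succ, add_assoc, pow_succ, ← mulVec_mulVec, ← mulVec_add]
      exact add_le_add le_rfl (hmono _ hstep)
  refine ne_top_of_le_ne_top (b := g x) ENNReal.ofReal_ne_top ?_
  rw [ENNReal.tsum_eq_iSup_nat]
  refine iSup_le fun N => ?_
  have := (hpart N) x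
  rw [Pi.add_apply, Finset.sum_apply] at this
  exact le_trans le_self_add this

/-- Mass is lost only by being killed at `o`, so the mass that has passed `o` and the mass still
alive add up to one. The latter tends to zero because its sum over time is finite. -/
theorem tsum_pow_eq_one (hsum : ∀ x, x ≠ o → ∑ y, M x y = 1) (hkill : ∀ y, M o y = 0)
    (hreach : ∀ x, Relation.ReflTransGen (fun a b => M a b ≠ 0) x o) (x : S) :
    ∑' t, (M ^ t) x o = 1 := by
  have h1 : ∀ N, ∑ t ∈ Finset.range N, (M ^ t) x o + (M ^ N *ᵥ 1) x = 1 := by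
    intro N
    induction N with
    | zero => simp
    | succ N ih =>
      rw [Finset.sum_range_succ, add_assoc, ← ih]
      congr 1
      rw [pow_succ, ← mulVec_mulVec, mulVec_one_eq_of_killed M o hsum hkill]
      simp only [mulVec, dotProduct, Pi.one_apply, mul_one]
      rw [← Finset.add_sum_erase _ _ (Finset.mem_univ o),
        ← Finset.add_sum_erase _ (fun y => (M ^ N) x y) (Finset.mem_univ o)]
      simp only [if_true, mul_zero, zero_add]
      congr 1
      exact Finset.sum_congr rfl fun y hy => by simp [Finset.ne_of_mem_erase hy]
  have h2 : Tendsto (fun N => (M ^ (N + 1) *ᵥ 1) x) atTop (𝓝 0) := by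
    have := ENNReal.tendsto_atTop_zero_of_tsum_ne_top
      (tsum_pow_mulVec_ne_top M o hsum hkill hreach x)
    refine this.congr fun N => ?_
    rw [pow_succ, ← mulVec_mulVec, mulVec_one_eq_of_killed M o hsum hkill]
  have h3 := ((ENNReal.tendsto_nat_tsum fun t => (M ^ t) x o).add
    ((tendsto_add_atTop_iff_nat (f := fun N => (M ^ N *ᵥ 1) x) 1).1 h2))
  rw [add_zero] at h3
  exact tendsto_nhds_unique h3 (tendsto_const_nhds.congr fun N => (h1 N).symm)

theorem tsum_pow_ne_top (hsum : ∀ x, x ≠ o → ∑ y, M x y = 1) (hkill : ∀ y, M o y = 0)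
    (hreach : ∀ x, Relation.ReflTransGen (fun a b => M a b ≠ 0) x o) (x y : S) :
    ∑' t, (M ^ t) x y ≠ ∞ := by
  by_cases hy : y = o
  · rw [hy, tsum_pow_eq_one M o hsum hkill hreach]
    exact ENNReal.one_ne_top
  · refine ne_top_of_le_ne_top (tsum_pow_mulVec_ne_top M o hsum hkill hreach x)
      (ENNReal.tsum_le_tsum fun t => ?_)
    refine le_trans ?_ (Finset.single_le_sum
      (f := fun y => (M ^ t) x y * if y = o then (0 : ℝ≥0∞) else 1)
      (fun _ _ => zero_le) (Finset.mem_univ y))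
    simp [hy]

end KilledChain

/-! ### Sums over paths as matrix powers -/

section PathSums

open Matrix

variable {S A : Type*} [Fintype S] [DecidableEq S]

theorem sum_paths_cons [AddCommMonoid A] (n : ℕ) (u : S) (f : (Fin (n + 2) → S) → A) :
    (∑ x : Fin (n + 2) → S, if x 0 = u then f x else 0)
      = ∑ v, ∑ y : Fin (n + 1) → S, if y 0 = v then f (Fin.cons u y) else 0 := by
  rw [← (Fin.consEquiv fun _ : Fin (n + 2) => S).sum_comp, Fintype.sum_prod_type, Finset.sum_comm,
    Finset.sum_comm (γ := S)]
  refine Finset.sum_congr rfl fun y _ => ?_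
  simp [Fin.consEquiv]

variable [CommSemiring A] (M : Matrix S S A)

theorem sum_paths_prod (φ : S → A) (n : ℕ) (u : S) :
    (∑ x : Fin (n + 1) → S, if x 0 = u then
      (∏ t : Fin n, M (x t.castSucc) (x t.succ)) * φ (x (Fin.last n)) else 0)
      = (M ^ n *ᵥ φ) u := by
  induction n generalizing u with
  | zero =>
    rw [← (Equiv.funUnique (Fin 1) S).symm.sum_comp]
    simp
  | succ n ih =>
    rw [sum_paths_cons, pow_succ', ← mulVec_mulVec]
    refine Finset.sum_congr rfl fun v _ => ?_
    rw [← ih v, Finset.mul_sum]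
    refine Finset.sum_congr rfl fun y _ => ?_
    split_ifs with h
    · rw [Fin.prod_univ_succ]
      simp only [← Fin.succ_last, Fin.castSucc_zero, Fin.cons_zero, Fin.cons_succ,
        ← Fin.succ_castSucc, h, mul_assoc]
    · simp

/-- First-step decomposition of an additive functional: the contribution of the first edge is
multiplied by the total weight of its continuations, which need not be one. -/
theorem sum_paths_prod_mul_sum_succ (g : S → S → A) (φ : S → A) (n : ℕ) (u : S) :
    (∑ x : Fin (n + 1 + 1) → S, if x 0 = u then
      (∏ t : Fin (n + 1), M (x t.castSucc) (x t.succ)) * φ (x (Fin.last (n + 1)))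
        * ∑ t : Fin (n + 1), g (x t.castSucc) (x t.succ) else 0)
      = ∑ v, M u v * (g u v * (M ^ n *ᵥ φ) v +
        ∑ x : Fin (n + 1) → S, if x 0 = v then
          (∏ t : Fin n, M (x t.castSucc) (x t.succ)) * φ (x (Fin.last n))
            * ∑ t : Fin n, g (x t.castSucc) (x t.succ) else 0) := by
  rw [sum_paths_cons]
  refine Finset.sum_congr rfl fun v _ => ?_
  rw [← sum_paths_prod, Finset.mul_sum, ← Finset.sum_add_distrib, Finset.mul_sum]
  refine Finset.sum_congr rfl fun y _ => ?_
  split_ifs with h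
  · rw [Fin.prod_univ_succ, Fin.sum_univ_succ]
    simp only [← Fin.succ_last, Fin.castSucc_zero, Fin.cons_zero, Fin.cons_succ,
      ← Fin.succ_castSucc, h]
    ring
  · simp

end PathSums
-- Trajectories and edge passages
namespace FlowGraph

variable {S : Type*} [Fintype S] {G : FlowGraph S}

open Matrix

lemma Traj.state_injective (u : S) : Function.Injective
    (fun τ : G.Traj u => (⟨τ.len, τ.state⟩ : Σ n : ℕ, Fin (n + 2) → S)) := by
  rintro ⟨n, x, _, _, _⟩ ⟨m, y, _, _, _⟩ h
  obtain ⟨rfl, h⟩ := Sigma.mk.inj_iff.1 h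
  obtain rfl := eq_of_heq h
  rfl

-- Weights that vanish off the edges make adjacency automatic, so trajectories can be traded for
-- arbitrary state sequences with prescribed endpoints.
open scoped Classical in
lemma tsum_traj (M : Matrix S S ℝ≥0∞) (hM : ∀ s s', ¬ G.Adj s s' → M s s' = 0) (u : S)
    (f : (n : ℕ) → (Fin (n + 2) → S) → ℝ≥0∞) :
    (∑' τ : G.Traj u, (∏ t : Fin (τ.len + 1), M (τ.state t.castSucc) (τ.state t.succ))
        * f τ.len τ.state)
      = ∑' n, ∑ x : Fin (n + 1 + 1) → S, if x 0 = u then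
          (∏ t : Fin (n + 1), M (x t.castSucc) (x t.succ))
            * (if x (Fin.last (n + 1)) = G.sink then 1 else 0) * f n x else 0 := by
  let F : (Σ n : ℕ, Fin (n + 2) → S) → ℝ≥0∞ := fun p => if p.2 0 = u then
    (∏ t : Fin (p.1 + 1), M (p.2 t.castSucc) (p.2 t.succ))
      * (if p.2 (Fin.last (p.1 + 1)) = G.sink then 1 else 0) * f p.1 p.2 else 0
  have hF : Function.support F ⊆ Set.range
      (fun τ : G.Traj u => (⟨τ.len, τ.state⟩ : Σ n : ℕ, Fin (n + 2) → S)) := by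
    rintro ⟨n, x⟩ hx
    have h0 : x 0 = u := by
      by_contra h
      exact hx (if_neg h)
    have h1 : x (Fin.last (n + 1)) = G.sink := by
      by_contra h
      exact hx (by simp [F, h])
    refine ⟨⟨n, x, h0, h1, fun t => ?_⟩, rfl⟩
    by_contra h
    refine hx ?_
    simp only [F]
    rw [Finset.prod_eq_zero (Finset.mem_univ t) (hM _ _ h)]
    simp
  calc _ = ∑' τ : G.Traj u, F ⟨τ.len, τ.state⟩ :=
        tsum_congr fun τ => by simp [F, τ.start_eq, τ.last_eq]
    _ = ∑' p, F p := (Traj.state_injective u).tsum_eq hF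
    _ = _ := by
      refine (ENNReal.tsum_sigma fun n x => F ⟨n, x⟩).trans ?_
      exact tsum_congr fun n => tsum_fintype _

lemma tsum_sum_antidiagonal (a b : ℕ → ℝ≥0∞) :
    ∑' n, ∑ p ∈ Finset.HasAntidiagonal.antidiagonal n, a p.1 * b p.2 = (∑' i, a i) * ∑' j, b j := by
  calc _ = ∑' n, ∑' p : Finset.HasAntidiagonal.antidiagonal n, a p.1.1 * b p.1.2 :=
        tsum_congr fun n => (Finset.tsum_subtype _ fun p : ℕ × ℕ => a p.1 * b p.2).symm
    _ = ∑' q : (Σ n : ℕ, Finset.HasAntidiagonal.antidiagonal n), a q.2.1.1 * b q.2.1.2 :=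
        (ENNReal.tsum_sigma _).symm
    _ = ∑' p : ℕ × ℕ, a p.1 * b p.2 :=
        Finset.HasAntidiagonal.sigmaAntidiagonalEquivProd.tsum_eq (fun p : ℕ × ℕ => a p.1 * b p.2)
    _ = _ := by
      refine (ENNReal.tsum_prod (f := fun i j => a i * b j)).trans ?_
      simp_rw [ENNReal.tsum_mul_left, ENNReal.tsum_mul_right]

open scoped Classical in
/-- The number of passages of a trajectory through the edge `s → s'`. -/
noncomputable def Traj.passages {u : S} (τ : G.Traj u) (s s' : S) : ℝ≥0∞ :=
  ∑ t : Fin (τ.len + 1), if τ.state t.castSucc = s ∧ τ.state t.succ = s' then 1 else 0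

open scoped Classical in
/-- The expected number of passages through an edge factors through the Green functions of the
weights. -/
lemma tsum_traj_passages (M : Matrix S S ℝ≥0∞) (hM : ∀ s s', ¬ G.Adj s s' → M s s' = 0)
    (u s s' : S) :
    (∑' τ : G.Traj u, (∏ t : Fin (τ.len + 1), M (τ.state t.castSucc) (τ.state t.succ))
        * τ.passages s s')
      = (∑' t, (M ^ t) u s) * M s s' * ∑' t, (M ^ t) s' G.sink := by
  have h := tsum_traj (G := G) M hM u
    (fun n x => ∑ t : Fin (n + 1), if x t.castSucc = s ∧ x t.succ = s' then 1 else 0)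
  refine h.trans ?_
  clear h
  -- A trajectory with `n + 1` edges has `i` edges before the marked one and `j` after it, where `i
  -- + j = n`; the sum over `n` is a Cauchy product.
  rw [mul_comm (∑' t, (M ^ t) u s), mul_assoc, ← tsum_sum_antidiagonal, ← ENNReal.tsum_mul_left]
  refine tsum_congr fun n => ?_
  have hφ : ∀ k v, (M ^ k *ᵥ fun y => if y = G.sink then (1 : ℝ≥0∞) else 0) v
      = (M ^ k) v G.sink := fun k v => by simp [mulVec, dotProduct]
  have hg : ∀ u n, ∑ v, M u v * ((if u = s ∧ v = s' then (1 : ℝ≥0∞) else 0)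
      * (M ^ n *ᵥ fun y => if y = G.sink then (1 : ℝ≥0∞) else 0) v)
      = M s s' * ((M ^ 0) u s * (M ^ n) s' G.sink) := by
    intro u n
    by_cases hu : u = s
    · subst hu
      simp [hφ]
    · simp [hu]
  induction n generalizing u with
  | zero =>
    refine (sum_paths_prod_mul_sum_succ M (fun a b => if a = s ∧ b = s' then (1 : ℝ≥0∞) else 0)
      (fun y => if y = G.sink then (1 : ℝ≥0∞) else 0) 0 u).trans ?_
    simp only [Finset.univ_eq_empty, Finset.sum_empty, mul_zero, ite_self, Finset.sum_const_zero,
      add_zero]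
    rw [hg]
    simp
  | succ n ih =>
    refine (sum_paths_prod_mul_sum_succ M (fun a b => if a = s ∧ b = s' then (1 : ℝ≥0∞) else 0)
      (fun y => if y = G.sink then (1 : ℝ≥0∞) else 0) (n + 1) u).trans ?_
    simp_rw [mul_add, Finset.sum_add_distrib]
    rw [hg, Finset.Nat.sum_antidiagonal_succ, mul_add]
    congr 1
    refine (Finset.sum_congr rfl fun v _ => congrArg (M u v * ·) (ih v)).trans ?_
    simp_rw [Finset.mul_sum]
    rw [Finset.sum_comm]
    refine Finset.sum_congr rfl fun p _ => ?_
    rw [pow_succ', mul_apply, Finset.sum_mul, Finset.mul_sum]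
    exact Finset.sum_congr rfl fun v _ => by ring

-- The sink has no outgoing edge, so only the last edge of a trajectory can enter it.
open scoped Classical in
lemma Traj.passages_sink {u : S} (τ : G.Traj u) (x : S) :
    τ.passages x G.sink = if τ.terminal = x then 1 else 0 := by
  unfold Traj.passages
  rw [Fin.sum_univ_castSucc, Finset.sum_eq_zero, zero_add]
  · rw [Fin.succ_last, τ.last_eq]
    simp only [Traj.terminal, and_true]
    congr
  · intro t _
    refine if_neg fun h => ?_
    have := τ.adj t.succ
    rw [← Fin.succ_castSucc, h.2] at this
    exact G.not_sink_adj _ this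

open scoped Classical in
lemma Traj.sum_passages_sink {u : S} (τ : G.Traj u) : ∑ x, τ.passages x G.sink = 1 := by
  simp [Traj.passages_sink]

open scoped Classical in
lemma Traj.sum_passages {u : S} (τ : G.Traj u) {s : S} (hs : s ≠ G.sink) :
    ∑ s', τ.passages s s' = ∑ t : Fin (τ.len + 2), if τ.state t = s then 1 else 0 := by
  unfold Traj.passages
  rw [Fin.sum_univ_castSucc (n := τ.len + 1), τ.last_eq, if_neg hs.symm, add_zero,
    Finset.sum_comm]
  refine Finset.sum_congr rfl fun t _ => ?_
  by_cases h : τ.state t.castSucc = s <;> simp [h]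

/-- Returns become finite linear combinations of passage counts, whose expectations are known from
the Green functions. -/
lemma Traj.sum_eq_sum_passages {u : S} (τ : G.Traj u) (g : S → S → ℝ) :
    ∑ t : Fin (τ.len + 1), g (τ.state t.castSucc) (τ.state t.succ)
      = ∑ s, ∑ s', (τ.passages s s').toReal * g s s' := by
  classical
  have h : ∀ s s', (τ.passages s s').toReal = ∑ t : Fin (τ.len + 1),
      if τ.state t.castSucc = s ∧ τ.state t.succ = s' then 1 else 0 := by
    intro s s'
    unfold Traj.passages
    rw [ENNReal.toReal_sum fun t _ => by split_ifs <;> simp]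
    exact Finset.sum_congr rfl fun t _ => by split_ifs <;> simp
  simp_rw [h, Finset.sum_mul]
  rw [Finset.sum_congr rfl fun s _ => Finset.sum_comm, Finset.sum_comm]
  refine Finset.sum_congr rfl fun t _ => ?_
  rw [Finset.sum_eq_single (τ.state t.castSucc), Finset.sum_eq_single (τ.state t.succ)]
  · simp
  · intro b _ hb
    simp [hb.symm]
  · simp
  · intro a _ ha
    simp [ha.symm]
  · simp

/-! ### Policies as transition matrices -/

lemma sum_dite_pmf (q : S → Prop) [DecidablePred q] (p : PMF {s // q s}) :
    ∑ s, (if h : q s then p ⟨s, h⟩ else 0) = 1 := by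
  rw [← p.tsum_coe, ← tsum_fintype (L := .unconditional S)]
  rw [← Subtype.val_injective.tsum_eq (g := fun s : {s // q s} => s.1)]
  · exact tsum_congr fun s => dif_pos s.2
  · intro s hs
    by_contra h
    refine hs (dif_neg fun hq => h ⟨⟨s, hq⟩, rfl⟩)

lemma ForwardPolicy.prob_of_not_adj (π : G.ForwardPolicy) (s s' : S) (h : ¬ G.Adj s s') :
    π.prob s s' = 0 := dif_neg h

lemma BackwardPolicy.prob_of_not_adj (PB : G.BackwardPolicy) (s s' : S) (h : ¬ G.Adj s s') :
    PB.prob s s' = 0 := dif_neg h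

lemma ForwardPolicy.sum_prob (π : G.ForwardPolicy) {s : S} (hs : s ≠ G.sink) :
    ∑ s', π.prob s s' = 1 := by
  classical
  rw [← sum_dite_pmf _ (π ⟨s, hs⟩)]
  refine Finset.sum_congr rfl fun s' _ => ?_
  unfold ForwardPolicy.prob
  congr

lemma BackwardPolicy.sum_prob (PB : G.BackwardPolicy) {s' : S} (hs : s' ≠ G.init) :
    ∑ s, PB.prob s s' = 1 := by
  classical
  rw [← sum_dite_pmf _ (PB ⟨s', hs⟩)]
  refine Finset.sum_congr rfl fun s' _ => ?_
  unfold BackwardPolicy.prob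
  congr

lemma ForwardPolicy.prob_sink (π : G.ForwardPolicy) (s' : S) : π.prob G.sink s' = 0 :=
  π.prob_of_not_adj _ _ (G.not_sink_adj s')

lemma ForwardPolicy.prob_le_one (π : G.ForwardPolicy) (s s' : S) : π.prob s s' ≤ 1 := by
  unfold ForwardPolicy.prob
  split_ifs
  · exact PMF.coe_le_one _ _
  · exact zero_le_one

lemma ForwardPolicy.prob_ne_top (π : G.ForwardPolicy) (s s' : S) : π.prob s s' ≠ ∞ :=
  ne_top_of_le_ne_top ENNReal.one_ne_top (π.prob_le_one s s')

lemma BackwardPolicy.prob_ne_top (PB : G.BackwardPolicy) (s s' : S) : PB.prob s s' ≠ ∞ := by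
  unfold BackwardPolicy.prob
  split_ifs
  · exact PMF.apply_ne_top _ _
  · exact ENNReal.zero_ne_top

/-- A forward policy is determined by its transition probabilities. -/
lemma ForwardPolicy.ext_prob {π ρ : G.ForwardPolicy}
    (h : ∀ s s', G.Adj s s' → π.prob s s' = ρ.prob s s') : π = ρ := by
  funext s
  refine PMF.ext fun s' => ?_
  have := h s.1 s'.1 s'.2
  simpa only [ForwardPolicy.prob, dif_pos s'.2] using this

/-- The matrix of the transition probabilities of a forward policy. -/
noncomputable def ForwardPolicy.mat (π : G.ForwardPolicy) : Matrix S S ℝ≥0∞ :=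
  Matrix.of π.prob

/-- The matrix of the probabilities `P_B(s ∣ s')`. -/
noncomputable def BackwardPolicy.mat (PB : G.BackwardPolicy) : Matrix S S ℝ≥0∞ :=
  Matrix.of PB.prob

open scoped Classical in
lemma ForwardPolicy.tsum_mat_pow_sink (π : G.ForwardPolicy)
    (hπ : ∀ s s', G.Adj s s' → π.prob s s' ≠ 0) (s : S) :
    ∑' t, (π.mat ^ t) s G.sink = 1 :=
  tsum_pow_eq_one π.mat G.sink (fun _ => π.sum_prob) π.prob_sink
    (fun x => Relation.ReflTransGen.mono hπ _ _ (G.reach_to_sink x)) s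

open scoped Classical in
lemma ForwardPolicy.tsum_mat_pow_ne_top (π : G.ForwardPolicy)
    (hπ : ∀ s s', G.Adj s s' → π.prob s s' ≠ 0) (s s' : S) :
    ∑' t, (π.mat ^ t) s s' ≠ ∞ :=
  tsum_pow_ne_top π.mat G.sink (fun _ => π.sum_prob) π.prob_sink
    (fun x => Relation.ReflTransGen.mono hπ _ _ (G.reach_to_sink x)) s s'

/-- Exactly one passage enters the sink, so total masses reduce to expected edge passages. -/
lemma tsum_terminal (f : ∀ {u : S}, G.Traj u → ℝ≥0∞) (u : S) :
    ∑' τ : G.Traj u, f τ = ∑ x, ∑' τ : G.Traj u, f τ * τ.passages x G.sink := by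
  rw [← Summable.tsum_finsetSum fun _ _ => ENNReal.summable]
  refine tsum_congr fun τ => ?_
  rw [← Finset.mul_sum, τ.sum_passages_sink, mul_one]

lemma ForwardPolicy.tsum_trajProb (π : G.ForwardPolicy)
    (hπ : ∀ s s', G.Adj s s' → π.prob s s' ≠ 0) {u : S} (hu : u ≠ G.sink) :
    ∑' τ : G.Traj u, π.trajProb τ = 1 := by
  classical
  rw [tsum_terminal (fun τ => π.trajProb τ)]
  have h1 := fun x => tsum_traj_passages π.mat π.prob_of_not_adj u x G.sink
  refine (Finset.sum_congr rfl fun x _ => h1 x).trans ?_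
  rw [π.tsum_mat_pow_sink hπ]
  simp only [mul_one]
  have h2 : ∀ t, (π.mat ^ (t + 1)) u G.sink = ∑ x, (π.mat ^ t) u x * π.mat x G.sink :=
    fun t => by rw [pow_succ, mul_apply]
  have h3 := π.tsum_mat_pow_sink hπ u
  -- Trajectories have at least one edge; since `u` is not the sink, the term of length zero in the
  -- hitting probability vanishes.
  rw [tsum_eq_zero_add' ENNReal.summable, pow_zero, one_apply_ne hu, zero_add] at h3
  simp_rw [h2] at h3
  rw [Summable.tsum_finsetSum fun _ _ => ENNReal.summable] at h3
  simpa only [ENNReal.tsum_mul_right] using h3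

/-! ### The backward chain and its Doob transform -/

namespace BackwardPolicy

variable (PB : G.BackwardPolicy)

open scoped Classical in
/-- The total weight of the paths from `s` to the sink: the expected number of visits to `s` of the
chain that follows `PB` from the sink. -/
noncomputable def visits (s : S) : ℝ≥0∞ := ∑' t, (PB.mat ^ t) s G.sink

variable (hPB : ∀ s s', G.Adj s s' → 0 < PB.prob s s')

-- Read through the transpose, this is the probability that the backward chain from `s` hits the
-- initial state, where it is killed.
include hPB in
open scoped Classical in
lemma tsum_mat_pow_init (s : S) : ∑' t, (PB.mat ^ t) G.init s = 1 := by
  have h := tsum_pow_eq_one PB.matᵀ G.init (fun _ => PB.sum_prob)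
    (fun y => PB.prob_of_not_adj _ _ (G.not_adj_init y))
    (fun x => Relation.ReflTransGen.mono (fun a b hab => (hPB b a hab).ne') _ _
      ((Relation.reflTransGen_swap).2 (G.reach_from_init x))) s
  simpa only [← transpose_pow, transpose_apply] using h

include hPB in
lemma visits_ne_top (s : S) : PB.visits s ≠ ∞ := by
  classical
  have h := tsum_pow_ne_top PB.matᵀ G.init (fun _ => PB.sum_prob)
    (fun y => PB.prob_of_not_adj _ _ (G.not_adj_init y))
    (fun x => Relation.ReflTransGen.mono (fun a b hab => (hPB b a hab).ne') _ _
      ((Relation.reflTransGen_swap).2 (G.reach_from_init x))) G.sink s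
  simp only [← transpose_pow, transpose_apply] at h
  unfold visits
  convert h

include hPB in
lemma visits_init : PB.visits G.init = 1 := PB.tsum_mat_pow_init hPB G.sink

open scoped Classical in
lemma visits_eq (s : S) :
    PB.visits s = (if s = G.sink then 1 else 0) + ∑ s', PB.prob s s' * PB.visits s' := by
  unfold visits
  rw [tsum_eq_zero_add' ENNReal.summable, pow_zero, one_apply]
  congr 1
  simp_rw [← ENNReal.tsum_mul_left]
  rw [← Summable.tsum_finsetSum fun _ _ => ENNReal.summable]
  exact tsum_congr fun t => by rw [pow_succ', mul_apply]; rfl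

lemma visits_sink : PB.visits G.sink = 1 := by
  rw [visits_eq, if_pos rfl, Finset.sum_eq_zero, add_zero]
  intro s _
  rw [PB.prob_of_not_adj _ _ (G.not_sink_adj s), zero_mul]

lemma visits_of_ne_sink {s : S} (hs : s ≠ G.sink) :
    PB.visits s = ∑ s', PB.prob s s' * PB.visits s' := by
  rw [visits_eq, if_neg hs, zero_add]

include hPB in
lemma visits_ne_zero (s : S) : PB.visits s ≠ 0 := by
  induction G.reach_to_sink s using Relation.ReflTransGen.head_induction_on with
  | refl => rw [visits_sink]; exact one_ne_zero
  | @head a b hab _ ih =>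
    rw [PB.visits_of_ne_sink (G.ne_sink_of_adj hab)]
    intro h
    have := (Finset.sum_eq_zero_iff.1 h) b (Finset.mem_univ b)
    exact (mul_ne_zero (hPB _ _ hab).ne' ih) this

-- Of the two Green functions around the edge, the one from the initial state equals one.
include hPB in
lemma tsum_trajProb_passages (s s' : S) :
    ∑' τ : G.Traj G.init, PB.trajProb τ * τ.passages s s' = PB.prob s s' * PB.visits s' := by
  classical
  refine (tsum_traj_passages PB.mat PB.prob_of_not_adj G.init s s').trans ?_
  have h := PB.tsum_mat_pow_init hPB s
  rw [← one_mul (PB.prob s s'), ← h]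
  unfold visits mat
  congr

include hPB in
lemma edgeFlow_eq (Ff : ℝ≥0∞) (s s' : S) :
    PB.edgeFlow Ff s s' = Ff * (PB.prob s s' * PB.visits s') := by
  rw [← PB.tsum_trajProb_passages hPB]
  rfl

-- Away from the sink, visits are counted by the outgoing passages, and harmonicity of `visits` sums
-- their flows.
include hPB in
lemma stateFlow_eq (Ff : ℝ≥0∞) {s : S} (hs : s ≠ G.sink) :
    PB.stateFlow Ff s = Ff * PB.visits s := by
  classical
  rw [PB.visits_of_ne_sink hs]
  simp_rw [← PB.tsum_trajProb_passages hPB]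
  rw [← Summable.tsum_finsetSum fun _ _ => ENNReal.summable]
  simp_rw [← Finset.mul_sum, Traj.sum_passages _ hs]
  unfold stateFlow
  congr

include hPB in
lemma prob_sink_of_rewardMatching {R : S → ℝ} (h : PB.RewardMatching R) {x : S}
    (hx : G.Adj x G.sink) : PB.prob x G.sink = ENNReal.ofReal (R x / G.totalReward R) := by
  rw [← h x hx, ← mul_one (PB.prob x G.sink), ← PB.visits_sink, ← PB.tsum_trajProb_passages hPB]
  refine tsum_congr fun τ => ?_
  rw [τ.passages_sink]
  split_ifs <;> simp

/-- The forward policy that induces the same distribution over trajectories as `PB`. -/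
noncomputable def forward : G.ForwardPolicy := fun s =>
  ⟨fun s' => PB.prob s.1 s'.1 * PB.visits s'.1 / PB.visits s.1, by
    classical
    rw [ENNReal.summable.hasSum_iff]
    refine (Subtype.val_injective.tsum_eq (g := fun s' : {s' // G.Adj s.1 s'} => s'.1)
      (f := fun s' => PB.prob s.1 s' * PB.visits s' / PB.visits s.1) ?_).trans ?_
    · intro s' hs'
      by_contra h
      refine hs' ?_
      have h' : ¬ G.Adj s.1 s' := fun hq => h ⟨⟨s', hq⟩, rfl⟩
      simp [PB.prob_of_not_adj _ _ h']
    -- Normalization is the harmonicity of `visits` away from the sink.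
    · simp_rw [tsum_fintype, div_eq_mul_inv]
      rw [← Finset.sum_mul, ← PB.visits_of_ne_sink s.2,
        ENNReal.mul_inv_cancel (PB.visits_ne_zero hPB _) (PB.visits_ne_top hPB _)]⟩

lemma forward_prob (s s' : S) :
    (PB.forward hPB).prob s s' = PB.prob s s' * PB.visits s' / PB.visits s := by
  unfold ForwardPolicy.prob
  split_ifs with h
  · rfl
  · simp [PB.prob_of_not_adj _ _ h]

lemma forward_prob_ne_zero (s s' : S) (h : G.Adj s s') : (PB.forward hPB).prob s s' ≠ 0 := by
  rw [forward_prob]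
  exact ENNReal.div_ne_zero.2 ⟨mul_ne_zero (hPB _ _ h).ne' (PB.visits_ne_zero hPB _),
    PB.visits_ne_top hPB _⟩

lemma corresponds_forward : Corresponds (PB.forward hPB) PB := by
  intro τ
  -- The ratios of weights telescope along a trajectory; both endpoint weights are one.
  have tele : ∀ (n : ℕ) (a : Fin n → ℝ≥0∞) (b : Fin (n + 1) → ℝ≥0∞), (∀ i, b i ≠ 0) →
      (∀ i, b i ≠ ∞) → (∏ t, a t * b t.succ / b t.castSucc) * b 0
        = (∏ t, a t) * b (Fin.last n) := by
    intro n
    induction n with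
    | zero => simp
    | succ n ih =>
      intro a b h0 h1
      rw [Fin.prod_univ_castSucc, Fin.prod_univ_castSucc a]
      have := ih (fun t => a t.castSucc) (fun t => b t.castSucc) (fun _ => h0 _) fun _ => h1 _
      simp only [Fin.castSucc_zero] at this
      rw [mul_right_comm]
      simp only [Fin.succ_castSucc]
      rw [this, mul_assoc, mul_assoc, Fin.succ_last,
        ENNReal.mul_div_cancel (h0 _) (h1 _)]
  have h := tele (τ.len + 1) (fun t => PB.prob (τ.state t.castSucc) (τ.state t.succ))
    (fun t => PB.visits (τ.state t)) (fun _ => PB.visits_ne_zero hPB _)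
    fun _ => PB.visits_ne_top hPB _
  rw [τ.start_eq, τ.last_eq, PB.visits_init hPB, PB.visits_sink, mul_one, mul_one] at h
  simpa only [ForwardPolicy.trajProb, BackwardPolicy.trajProb, forward_prob] using h

/-- Equal trajectory laws give equal expected edge passages. These are positive on edges, so `P` is
too and hence reaches the sink almost surely. Its passages are then visits times `P.prob`; summing
over children identifies the visits, and dividing identifies `P`. -/
lemma eq_forward_of_corresponds {P : G.ForwardPolicy} (hP : Corresponds P PB) :
    P = PB.forward hPB := by
  classical
  have key : ∀ s s', (∑' t, (P.mat ^ t) G.init s) * P.prob s s' * ∑' t, (P.mat ^ t) s' G.sink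
      = PB.prob s s' * PB.visits s' := by
    intro s s'
    rw [← PB.tsum_trajProb_passages hPB]
    simp_rw [← hP _]
    exact (tsum_traj_passages P.mat P.prob_of_not_adj G.init s s').symm
  have hpos : ∀ s s', G.Adj s s' → P.prob s s' ≠ 0 := by
    intro s s' h h0
    have := key s s'
    rw [h0, mul_zero, zero_mul] at this
    exact mul_ne_zero (hPB _ _ h).ne' (PB.visits_ne_zero hPB s') this.symm
  simp_rw [P.tsum_mat_pow_sink hpos, mul_one] at key
  refine ForwardPolicy.ext_prob fun s s' h => ?_
  have hs := G.ne_sink_of_adj h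
  have hA : ∑' t, (P.mat ^ t) G.init s = PB.visits s := by
    rw [PB.visits_of_ne_sink hs]
    simp_rw [← key, ← Finset.mul_sum]
    rw [P.sum_prob hs, mul_one]
  rw [forward_prob, ← key, hA, mul_comm, mul_div_assoc,
    ENNReal.div_self (PB.visits_ne_zero hPB s) (PB.visits_ne_top hPB s), mul_one]

end BackwardPolicy

end FlowGraph

/-! ### Potentials minus accumulated gaps -/

section GapDecomposition

open Matrix Filter Topology

variable {S : Type*} [Fintype S] [DecidableEq S] {K : Matrix S S ℝ}

theorem pow_mulVec_mono (hK : ∀ a b, 0 ≤ K a b) {u v : S → ℝ} (huv : u ≤ v) (t : ℕ) :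
    K ^ t *ᵥ u ≤ K ^ t *ᵥ v := by
  induction t with
  | zero => simpa
  | succ t ih =>
    rw [pow_succ', ← mulVec_mulVec, ← mulVec_mulVec]
    exact fun x => Finset.sum_le_sum fun y _ => mul_le_mul_of_nonneg_left (ih y) (hK x y)

theorem pow_mulVec_nonneg (hK : ∀ a b, 0 ≤ K a b) {v : S → ℝ} (hv : ∀ a, 0 ≤ v a) (t : ℕ) (u : S) :
    0 ≤ (K ^ t *ᵥ v) u := by
  have h : (0 : S → ℝ) ≤ v := hv
  simpa using pow_mulVec_mono hK h t u

theorem pow_mulVec_one (hsum : ∀ a, ∑ b, K a b = 1) (t : ℕ) : K ^ t *ᵥ 1 = 1 := by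
  induction t with
  | zero => simp
  | succ t ih =>
    rw [pow_succ', ← mulVec_mulVec, ih]
    funext x
    simpa [mulVec, dotProduct] using hsum x

theorem pow_apply_nonneg_of_nonneg (hK : ∀ a b, 0 ≤ K a b) (t : ℕ) (a b : S) :
    0 ≤ (K ^ t) a b := by
  have h : (0 : S → ℝ) ≤ Pi.single b 1 := Pi.single_nonneg.2 zero_le_one
  have := pow_mulVec_mono hK h t a
  simpa using this

/-- The limiting behaviour of a potential difference minus accumulated gaps: if the gaps force the
chain into the target, then the limit is either `⊥`, or the initial potential minus the total gap. -/
theorem limsup_potential_sub_gap (o : S) (hK : ∀ a b, 0 ≤ K a b) (hsum : ∀ a, ∑ b, K a b = 1)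
    {gap φ h : S → ℝ} {C : ℝ} (hgap : ∀ a, 0 ≤ gap a) (hφ : φ o = 0) (hh : ∀ a, 0 ≤ h a)
    (hdrift : ∀ a, (if a = o then 0 else 1) + (K *ᵥ h) a ≤ h a + C * gap a) (u : S) :
    (¬ Summable fun t => (K ^ t *ᵥ gap) u) ∧ limsup (fun N : ℕ => ((φ u - (K ^ N *ᵥ φ) u
        - ∑ t ∈ Finset.range N, (K ^ t *ᵥ gap) u : ℝ) : EReal)) atTop = ⊥ ∨
      ∃ D : ℝ, HasSum (fun t => (K ^ t *ᵥ gap) u) D ∧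
        limsup (fun N : ℕ => ((φ u - (K ^ N *ᵥ φ) u
          - ∑ t ∈ Finset.range N, (K ^ t *ᵥ gap) u : ℝ) : EReal)) atTop = ((φ u - D : ℝ) : EReal) := by
  let alive : S → ℝ := fun a => if a = o then 0 else 1
  have halive0 : (0 : S → ℝ) ≤ alive := fun a => by simp only [alive]; split_ifs <;> simp
  have halive1 : alive ≤ 1 := fun a => by simp only [alive]; split_ifs <;> simp
  have hnn : ∀ {v : S → ℝ}, 0 ≤ v → ∀ t, 0 ≤ (K ^ t *ᵥ v) u := fun hv t =>
    pow_mulVec_nonneg hK hv t u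
  have hgapt : ∀ t, 0 ≤ (K ^ t *ᵥ gap) u := hnn hgap
  -- As `φ` vanishes at `o`, its mean is controlled by the probability of being outside `o`.
  obtain ⟨B, hB0, hB⟩ : ∃ B : ℝ, 0 ≤ B ∧ ∀ t, |(K ^ t *ᵥ φ) u| ≤ B * (K ^ t *ᵥ alive) u := by
    refine ⟨∑ a, |φ a|, Finset.sum_nonneg fun _ _ => abs_nonneg _, fun t => ?_⟩
    have h1 : ∀ a, |φ a| ≤ ((∑ a, |φ a|) • alive) a := by
      intro a
      by_cases ha : a = o
      · simp [ha, hφ, alive]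
      · simpa [alive, ha] using Finset.single_le_sum (f := fun a => |φ a|)
          (fun _ _ => abs_nonneg _) (Finset.mem_univ a)
    have h2 := pow_mulVec_mono hK (fun a => (le_abs_self _).trans (h1 a)) t u
    have h3 := pow_mulVec_mono hK (fun a => (neg_abs_le _).trans' (neg_le_neg (h1 a))) t u
    rw [mulVec_smul] at h2
    have h4 : (K ^ t *ᵥ fun a => -(((∑ a, |φ a|) • alive) a)) u
        = -((∑ a, |φ a|) * (K ^ t *ᵥ alive) u) := by
      have : (fun a => -(((∑ a, |φ a|) • alive) a)) = -((∑ a, |φ a|) • alive) := rfl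
      rw [this, mulVec_neg, mulVec_smul]
      rfl
    rw [h4] at h3
    exact abs_le.2 ⟨h3, h2⟩
  by_cases hs : Summable fun t => (K ^ t *ᵥ gap) u
  · right
    obtain ⟨D, hD⟩ := hs
    refine ⟨D, hD, ?_⟩
    -- The drift inequality telescopes: the expected time outside `o` is bounded by the initial `h`
    -- plus `C` times the accumulated gap.
    have hpart : ∀ N, ∑ t ∈ Finset.range N, (K ^ t *ᵥ alive) u
        + (K ^ N *ᵥ h) u ≤ h u + C * ∑ t ∈ Finset.range N, (K ^ t *ᵥ gap) u := by
      intro N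
      induction N with
      | zero => simp
      | succ N ih =>
        have h1 : (K ^ N *ᵥ (alive + K *ᵥ h)) u ≤ (K ^ N *ᵥ (h + C • gap)) u :=
          pow_mulVec_mono hK hdrift N u
        rw [mulVec_add, mulVec_add, mulVec_smul, mulVec_mulVec, ← pow_succ] at h1
        simp only [Pi.add_apply, Pi.smul_apply, smul_eq_mul] at h1
        rw [Finset.sum_range_succ, Finset.sum_range_succ, mul_add]
        linarith
    have hsum_alive : Summable fun t => (K ^ t *ᵥ alive) u := by
      refine summable_of_sum_range_le (c := h u + |C| * D) (hnn halive0) fun N => ?_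
      have h1 : ∑ t ∈ Finset.range N, (K ^ t *ᵥ gap) u ≤ D :=
        sum_le_hasSum _ (fun t _ => hgapt t) hD
      have h2 : 0 ≤ ∑ t ∈ Finset.range N, (K ^ t *ᵥ gap) u :=
        Finset.sum_nonneg fun t _ => hgapt t
      have h3 := mul_le_mul_of_nonneg_right (le_abs_self C) h2
      have h4 := mul_le_mul_of_nonneg_left h1 (abs_nonneg C)
      have h5 := hnn hh N
      linarith [hpart N]
    have hφ0 : Tendsto (fun N => (K ^ N *ᵥ φ) u) atTop (𝓝 0) := by
      refine squeeze_zero_norm hB ?_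
      simpa using hsum_alive.tendsto_atTop_zero.const_mul B
    refine Tendsto.limsup_eq ?_
    rw [EReal.tendsto_coe]
    simpa using (tendsto_const_nhds.sub hφ0).sub hD.tendsto_sum_nat
  · refine Or.inl ⟨hs, ?_⟩
    refine Tendsto.limsup_eq ?_
    rw [EReal.tendsto_coe_nhds_bot_iff]
    have h1 := (not_summable_iff_tendsto_nat_atTop_of_nonneg hgapt).1 hs
    have h2 := tendsto_atBot_add_const_left atTop (φ u + B) (tendsto_neg_atTop_atBot.comp h1)
    refine tendsto_atBot_mono (fun N => ?_) h2
    have h3 := hB N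
    have h4 : (K ^ N *ᵥ alive) u ≤ 1 := by
      have := pow_mulVec_mono hK halive1 N u
      rwa [pow_mulVec_one hsum] at this
    have h5 := mul_le_mul_of_nonneg_left h4 hB0
    have h6 := neg_abs_le ((K ^ N *ᵥ φ) u)
    simp only [Function.comp]
    linarith

end GapDecomposition

/-! ### Returns and Kullback–Leibler gaps of a policy -/

namespace FlowGraph

variable {S : Type*} [Fintype S] {G : FlowGraph S}

open Matrix

/-- The transition matrix, with real entries, of the chain that stays in the sink. -/
noncomputable def ForwardPolicy.realKernel (π : G.ForwardPolicy) : Matrix S S ℝ :=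
  Matrix.of fun a b => (π.kernel a b).toReal

lemma ForwardPolicy.realKernel_of_ne (π : G.ForwardPolicy) {a : S} (ha : a ≠ G.sink) (b : S) :
    π.realKernel a b = (π.prob a b).toReal := by
  simp [realKernel, kernel, ha]

open scoped Classical in
lemma ForwardPolicy.realKernel_sink (π : G.ForwardPolicy) (b : S) :
    π.realKernel G.sink b = if b = G.sink then 1 else 0 := by
  simp only [realKernel, kernel, Matrix.of_apply, if_true]
  split_ifs <;> simp

lemma ForwardPolicy.realKernel_nonneg (π : G.ForwardPolicy) (a b : S) : 0 ≤ π.realKernel a b :=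
  ENNReal.toReal_nonneg

lemma ForwardPolicy.sum_toReal_prob (π : G.ForwardPolicy) {a : S} (ha : a ≠ G.sink) :
    ∑ b, (π.prob a b).toReal = 1 := by
  rw [← ENNReal.toReal_sum fun b _ => π.prob_ne_top a b, π.sum_prob ha, ENNReal.toReal_one]

lemma ForwardPolicy.sum_realKernel (π : G.ForwardPolicy) (a : S) :
    ∑ b, π.realKernel a b = 1 := by
  classical
  by_cases ha : a = G.sink
  · subst ha
    simp [realKernel_sink]
  · simp_rw [π.realKernel_of_ne ha]
    exact π.sum_toReal_prob ha

lemma ForwardPolicy.realKernel_mulVec_sink (π : G.ForwardPolicy) (v : S → ℝ) :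
    (π.realKernel *ᵥ v) G.sink = v G.sink := by
  classical
  simp [mulVec, dotProduct, realKernel_sink]

lemma ForwardPolicy.realKernel_mulVec_of_ne (π : G.ForwardPolicy) {a : S} (ha : a ≠ G.sink)
    (v : S → ℝ) : (π.realKernel *ᵥ v) a = ∑ b, (π.prob a b).toReal * v b := by
  simp_rw [mulVec, dotProduct, π.realKernel_of_ne ha]

lemma ForwardPolicy.expectedReturn_zero (π : G.ForwardPolicy) (r : S → S → ℝ) (lam : ℝ) (u : S) :
    π.expectedReturn r lam 0 u = 0 := by
  simp [expectedReturn]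

-- First-step decomposition; the weights of the continuations sum to one because the chain is kept
-- in the sink rather than killed.
open scoped Classical in
lemma ForwardPolicy.expectedReturn_succ (π : G.ForwardPolicy) (r : S → S → ℝ) (lam : ℝ) (N : ℕ)
    (u : S) : π.expectedReturn r lam (N + 1) u = ∑ v, π.realKernel u v *
      ((if u = G.sink then 0 else r u v + lam * π.entropy u) + π.expectedReturn r lam N v) := by
  have h : ∀ N u, π.expectedReturn r lam N u = ∑ x : Fin (N + 1) → S, if x 0 = u then
      (∏ t : Fin N, π.realKernel (x t.castSucc) (x t.succ)) * (1 : S → ℝ) (x (Fin.last N))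
        * ∑ t : Fin N, (fun a b => if a = G.sink then 0 else r a b + lam * π.entropy a)
          (x t.castSucc) (x t.succ) else 0 := by
    intro N u
    simp only [expectedReturn, ENNReal.toReal_prod, Pi.one_apply, mul_one]
    rfl
  rw [h]
  refine (sum_paths_prod_mul_sum_succ π.realKernel
    (fun a b => if a = G.sink then 0 else r a b + lam * π.entropy a) 1 N u).trans ?_
  simp_rw [h, pow_mulVec_one π.sum_realKernel, Pi.one_apply, mul_one]

/-- If the expected one-step reward is a potential difference minus a gap, then the expected return
is a potential difference minus accumulated gaps. -/
lemma ForwardPolicy.expectedReturn_eq [DecidableEq S] (π : G.ForwardPolicy) (r : S → S → ℝ)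
    (lam : ℝ) {φ gap : S → ℝ} (hgap : gap G.sink = 0)
    (hstep : ∀ a, a ≠ G.sink → ∑ b, (π.prob a b).toReal * (r a b + lam * π.entropy a)
      = φ a - ∑ b, (π.prob a b).toReal * φ b - gap a) (N : ℕ) (u : S) :
    π.expectedReturn r lam N u = φ u - (π.realKernel ^ N *ᵥ φ) u
      - ∑ t ∈ Finset.range N, (π.realKernel ^ t *ᵥ gap) u := by
  have hstep' : ∀ a, ∑ b, π.realKernel a b * (if a = G.sink then 0 else r a b + lam * π.entropy a)
      = φ a - (π.realKernel *ᵥ φ) a - gap a := by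
    intro a
    by_cases ha : a = G.sink
    · subst ha
      simp [realKernel_mulVec_sink, hgap]
    · simp_rw [π.realKernel_mulVec_of_ne ha, π.realKernel_of_ne ha, if_neg ha]
      exact hstep a ha
  induction N generalizing u with
  | zero => simp [expectedReturn_zero]
  | succ N ih =>
    rw [expectedReturn_succ]
    simp_rw [mul_add, Finset.sum_add_distrib]
    have h1 := hstep' u
    have h2 : ∑ v, π.realKernel u v * π.expectedReturn r lam N v
        = (π.realKernel *ᵥ (φ - π.realKernel ^ N *ᵥ φ
          - ∑ t ∈ Finset.range N, π.realKernel ^ t *ᵥ gap)) u := by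
      refine Finset.sum_congr rfl fun v _ => ?_
      rw [ih v]
      simp
    rw [h2, mulVec_sub, mulVec_sub, mulVec_mulVec, ← pow_succ', mulVec_sum,
      Finset.sum_range_succ']
    simp_rw [mulVec_mulVec, ← pow_succ']
    rw [pow_zero, one_mulVec]
    simp only [Pi.sub_apply, Finset.sum_apply]
    have h3 : (∑ v, π.realKernel u v * if u = G.sink then 0 else r u v + lam * π.entropy u)
        = φ u - (π.realKernel *ᵥ φ) u - gap u := by
      rw [← h1]
    convert congrArg (· + ((π.realKernel *ᵥ φ) u - (π.realKernel ^ (N + 1) *ᵥ φ) u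
      - ∑ t ∈ Finset.range N, (π.realKernel ^ (t + 1) *ᵥ gap) u)) h3 using 1
    · congr!
    · ring

open InformationTheory in
/-- The Kullback–Leibler divergence of `π(· ∣ s)` from `ρ(· ∣ s)`, which is `0` at the sink. -/
noncomputable def ForwardPolicy.klGap (π ρ : G.ForwardPolicy) (s : S) : ℝ :=
  ∑ s', (ρ.prob s s').toReal * klFun ((π.prob s s').toReal / (ρ.prob s s').toReal)

open InformationTheory

lemma ForwardPolicy.klGap_nonneg (π ρ : G.ForwardPolicy) (s : S) : 0 ≤ π.klGap ρ s :=
  Finset.sum_nonneg fun _ _ => mul_nonneg ENNReal.toReal_nonneg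
    (klFun_nonneg (div_nonneg ENNReal.toReal_nonneg ENNReal.toReal_nonneg))

lemma ForwardPolicy.klGap_sink (π ρ : G.ForwardPolicy) : π.klGap ρ G.sink = 0 :=
  Finset.sum_eq_zero fun s _ => by simp [ρ.prob_sink]

lemma ForwardPolicy.klGap_self (π : G.ForwardPolicy) (s : S) : π.klGap π s = 0 := by
  refine Finset.sum_eq_zero fun s' _ => ?_
  by_cases h : (π.prob s s').toReal = 0
  · rw [h, zero_mul]
  · rw [div_self h, klFun_one, mul_zero]

lemma ForwardPolicy.prob_eq_of_klGap_eq_zero {π ρ : G.ForwardPolicy}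
    (hρ : ∀ s s', G.Adj s s' → ρ.prob s s' ≠ 0) {s : S} (h : π.klGap ρ s = 0) (s' : S) :
    π.prob s s' = ρ.prob s s' := by
  by_cases hs : G.Adj s s'
  · have h1 := (Finset.sum_eq_zero_iff_of_nonneg fun _ _ => mul_nonneg ENNReal.toReal_nonneg
      (klFun_nonneg (div_nonneg ENNReal.toReal_nonneg ENNReal.toReal_nonneg))).1 h s'
      (Finset.mem_univ s')
    have h2 : (ρ.prob s s').toReal ≠ 0 :=
      (ENNReal.toReal_pos (hρ s s' hs) (ρ.prob_ne_top s s')).ne'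
    have h3 := (mul_eq_zero.1 h1).resolve_left h2
    rw [klFun_eq_zero_iff (div_nonneg ENNReal.toReal_nonneg ENNReal.toReal_nonneg),
      div_eq_one_iff_eq h2] at h3
    exact (ENNReal.toReal_eq_toReal_iff' (π.prob_ne_top s s') (ρ.prob_ne_top s s')).1 h3
  · rw [π.prob_of_not_adj _ _ hs, ρ.prob_of_not_adj _ _ hs]

/-- The regularized one-step identity: if rewards are potential differences plus the
log-probabilities of `ρ`, then the expected one-step reward is a potential difference minus the
Kullback–Leibler divergence from `ρ`. -/
lemma ForwardPolicy.step_eq {π ρ : G.ForwardPolicy}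
    (hρ : ∀ s s', G.Adj s s' → ρ.prob s s' ≠ 0) {r : S → S → ℝ} {φ : S → ℝ}
    (hr : ∀ a b, G.Adj a b → r a b = φ a + Real.log (ρ.prob a b).toReal - φ b)
    {a : S} (ha : a ≠ G.sink) :
    ∑ b, (π.prob a b).toReal * (r a b + 1 * π.entropy a)
      = φ a - ∑ b, (π.prob a b).toReal * φ b - π.klGap ρ a := by
  -- `klFun x` is `x log x + 1 - x`, so each term carries an extra difference of probabilities;
  -- these cancel in the sum over `b`.
  have h1 : ∀ b, (π.prob a b).toReal * r a b + Real.negMulLog (π.prob a b).toReal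
      = (π.prob a b).toReal * φ a - (π.prob a b).toReal * φ b
        - (ρ.prob a b).toReal * klFun ((π.prob a b).toReal / (ρ.prob a b).toReal)
        + (ρ.prob a b).toReal - (π.prob a b).toReal := by
    intro b
    by_cases hab : G.Adj a b
    · have hq : (ρ.prob a b).toReal ≠ 0 :=
        (ENNReal.toReal_pos (hρ a b hab) (ρ.prob_ne_top a b)).ne'
      rw [hr a b hab, klFun_apply, Real.negMulLog]
      by_cases hp : (π.prob a b).toReal = 0
      · simp [hp]
      · rw [Real.log_div hp hq]
        field_simp
        ring
    · simp [π.prob_of_not_adj _ _ hab, ρ.prob_of_not_adj _ _ hab]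
  have h2 : ∑ b, (π.prob a b).toReal * (r a b + 1 * π.entropy a)
      = ∑ b, ((π.prob a b).toReal * r a b + Real.negMulLog (π.prob a b).toReal) := by
    simp_rw [mul_add, one_mul, Finset.sum_add_distrib]
    rw [← Finset.sum_mul, π.sum_toReal_prob ha, one_mul]
    rfl
  rw [h2, Finset.sum_congr rfl fun b _ => h1 b, Finset.sum_sub_distrib, Finset.sum_add_distrib,
    Finset.sum_sub_distrib, Finset.sum_sub_distrib, ← Finset.sum_mul, π.sum_toReal_prob ha,
    ρ.sum_toReal_prob ha, klGap]
  ring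

/-- The Lyapunov function of `ρ` serves for `π` wherever the gap vanishes, since the two policies
agree there. The finitely many other states have positive gap, and a large `C` compensates for any
increase. -/
lemma ForwardPolicy.exists_drift (π : G.ForwardPolicy) {ρ : G.ForwardPolicy}
    (hρ : ∀ s s', G.Adj s s' → ρ.prob s s' ≠ 0) [DecidableEq S] :
    ∃ (h : S → ℝ) (C : ℝ), (∀ a, 0 ≤ h a) ∧
      ∀ a, (if a = G.sink then 0 else 1) + (π.realKernel *ᵥ h) a ≤ h a + C * π.klGap ρ a := by
  obtain ⟨h, h0, hh⟩ := exists_lyapunov (fun a b => (ρ.prob a b).toReal) G.sink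
    (fun _ _ => ENNReal.toReal_nonneg) (fun a ha => ρ.sum_toReal_prob ha)
    (fun a => Relation.ReflTransGen.mono (fun a b hab => ENNReal.toReal_pos (hρ a b hab)
      (ρ.prob_ne_top a b)) _ _ (G.reach_to_sink a))
  have hK : ∀ a, 0 ≤ (π.realKernel *ᵥ h) a := fun a =>
    Finset.sum_nonneg fun b _ => mul_nonneg (π.realKernel_nonneg a b) (h0 b)
  -- Where the gap is zero, division by zero gives `c a = 0`; elsewhere `c a` times the gap is
  -- exactly `1 + (π.realKernel *ᵥ h) a`.
  let c : S → ℝ := fun a => (1 + (π.realKernel *ᵥ h) a) / π.klGap ρ a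
  have hc : ∀ a, 0 ≤ c a := fun a =>
    div_nonneg (add_nonneg zero_le_one (hK a)) (π.klGap_nonneg ρ a)
  refine ⟨h, ∑ a, c a, h0, fun a => ?_⟩
  by_cases ha : a = G.sink
  · subst ha
    simp [realKernel_mulVec_sink, klGap_sink]
  rw [if_neg ha]
  by_cases hgap : π.klGap ρ a = 0
  · rw [π.realKernel_mulVec_of_ne ha, hgap, mul_zero, add_zero]
    simp_rw [prob_eq_of_klGap_eq_zero hρ hgap]
    exact hh a ha
  · have h1 : c a * π.klGap ρ a ≤ (∑ a, c a) * π.klGap ρ a :=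
      mul_le_mul_of_nonneg_right (Finset.single_le_sum (fun a _ => hc a) (Finset.mem_univ a))
        (π.klGap_nonneg ρ a)
    rw [div_mul_cancel₀ _ hgap] at h1
    linarith [h0 a]

/-! ### Values and the optimal policy -/

section Value

variable {ρ : G.ForwardPolicy} (hρ : ∀ s s', G.Adj s s' → ρ.prob s s' ≠ 0) {r : S → S → ℝ}
  {φ : S → ℝ} (hφ : φ G.sink = 0)
  (hr : ∀ a b, G.Adj a b → r a b = φ a + Real.log (ρ.prob a b).toReal - φ b)

include hρ hφ hr

open scoped Classical in
lemma ForwardPolicy.value_eq (π : G.ForwardPolicy) (u : S) :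
    (¬ Summable fun t => (π.realKernel ^ t *ᵥ π.klGap ρ) u) ∧ π.value r 1 u = ⊥ ∨
      ∃ D : ℝ, HasSum (fun t => (π.realKernel ^ t *ᵥ π.klGap ρ) u) D ∧
      π.value r 1 u = ((φ u - D : ℝ) : EReal) := by
  obtain ⟨h, C, h0, hd⟩ := π.exists_drift hρ
  unfold ForwardPolicy.value
  simp_rw [π.expectedReturn_eq r 1 (π.klGap_sink ρ) (fun a ha => step_eq hρ hr ha)]
  exact limsup_potential_sub_gap G.sink π.realKernel_nonneg π.sum_realKernel (π.klGap_nonneg ρ)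
    hφ h0 hd u

lemma ForwardPolicy.value_le (π : G.ForwardPolicy) (u : S) : π.value r 1 u ≤ (φ u : EReal) := by
  classical
  rcases value_eq hρ hφ hr π u with ⟨-, h⟩ | ⟨D, hD, h⟩
  · rw [h]
    exact bot_le
  · rw [h, EReal.coe_le_coe_iff, sub_le_self_iff]
    exact hD.nonneg fun t =>
      pow_mulVec_nonneg π.realKernel_nonneg (π.klGap_nonneg ρ) t u

lemma ForwardPolicy.value_self (u : S) : ρ.value r 1 u = (φ u : EReal) := by
  classical
  have h0 : ρ.klGap ρ = 0 := funext fun s => ρ.klGap_self s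
  rcases value_eq hρ hφ hr ρ u with ⟨hs, -⟩ | ⟨D, hD, h⟩
  · refine absurd ?_ hs
    simp only [h0, mulVec_zero, Pi.zero_apply]
    exact summable_zero
  · simp only [h0, mulVec_zero, Pi.zero_apply] at hD
    rw [h, hD.unique hasSum_zero, sub_zero]

lemma optValue_eq (u : S) : G.optValue r 1 u = (φ u : EReal) :=
  le_antisymm (iSup_le fun π => ForwardPolicy.value_le hρ hφ hr π u)
    ((ForwardPolicy.value_self hρ hφ hr u).symm.le.trans (le_iSup (fun π => π.value r 1 u) ρ))

lemma ForwardPolicy.isOptimal_iff (π : G.ForwardPolicy) : π.IsOptimal r 1 ↔ π = ρ := by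
  classical
  constructor
  · intro hπ
    have h1 := hπ ρ
    rw [value_self hρ hφ hr] at h1
    rcases value_eq hρ hφ hr π G.init with ⟨-, h⟩ | ⟨D, hD, h⟩
    · rw [h] at h1
      exact absurd (le_bot_iff.1 h1) (EReal.coe_ne_bot _)
    · rw [h, EReal.coe_le_coe_iff] at h1
      have hnn : ∀ t, 0 ≤ (π.realKernel ^ t *ᵥ π.klGap ρ) G.init := fun t =>
        pow_mulVec_nonneg π.realKernel_nonneg (π.klGap_nonneg ρ) t G.init
      have hD0 : D = 0 := le_antisymm (by linarith) (hD.nonneg hnn)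
      rw [hD0, hasSum_zero_iff_of_nonneg hnn] at hD
      have hz : ∀ s t, 0 < (π.realKernel ^ t) G.init s → π.klGap ρ s = 0 := by
        intro s t hs
        have h2 := (Finset.sum_eq_zero_iff_of_nonneg fun b _ =>
          mul_nonneg (pow_apply_nonneg_of_nonneg π.realKernel_nonneg t G.init b)
            (π.klGap_nonneg ρ b)).1 (congrFun hD t) s (Finset.mem_univ s)
        exact (mul_eq_zero.1 h2).resolve_left hs.ne'
      -- At a visited state the gap vanishes, so `π` agrees there with `ρ`, which charges every
      -- edge; visits thus spread along paths from the initial state.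
      have hvisit : ∀ s, ∃ t, 0 < (π.realKernel ^ t) G.init s := by
        intro s
        induction G.reach_from_init s with
        | refl => exact ⟨0, by simp⟩
        | @tail a b _ hab ih =>
          obtain ⟨t, ht⟩ := ih
          refine ⟨t + 1, ?_⟩
          rw [pow_succ, mul_apply]
          refine lt_of_lt_of_le (mul_pos ht ?_) (Finset.single_le_sum
            (f := fun c => (π.realKernel ^ t) G.init c * π.realKernel c b) (fun c _ =>
              mul_nonneg (pow_apply_nonneg_of_nonneg π.realKernel_nonneg t G.init c)
                (π.realKernel_nonneg c b)) (Finset.mem_univ a))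
          rw [π.realKernel_of_ne (G.ne_sink_of_adj hab), prob_eq_of_klGap_eq_zero hρ (hz a t ht)]
          exact ENNReal.toReal_pos (hρ a b hab) (ρ.prob_ne_top a b)
      refine ext_prob fun s s' _ => ?_
      obtain ⟨t, ht⟩ := hvisit s
      exact prob_eq_of_klGap_eq_zero hρ (hz s t ht) s'
  · rintro rfl π'
    rw [value_self hρ hφ hr]
    exact value_le hρ hφ hr π' _

/-- The return is linear in the passage counts, whose expectations `N a * ρ.prob a b` are finite;
this gives convergence. The gap of `ρ` from itself is zero, and summation by parts against the Green
function leaves `φ u`. -/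
lemma ForwardPolicy.hasSum_trajReturn (u : S) :
    HasSum (fun τ : G.Traj u => (ρ.trajProb τ).toReal * ρ.trajReturn r 1 τ) (φ u) := by
  classical
  let N : S → ℝ≥0∞ := fun a => ∑' t, (ρ.mat ^ t) u a
  have hN : ∀ a, N a ≠ ∞ := ρ.tsum_mat_pow_ne_top hρ u
  have hNrec : ∀ b, (N b).toReal = (if b = u then 1 else 0)
      + ∑ a, (N a).toReal * (ρ.prob a b).toReal := by
    intro b
    have h1 : N b = (if b = u then 1 else 0) + ∑ a, N a * ρ.prob a b := by
      simp only [N]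
      rw [tsum_eq_zero_add' ENNReal.summable, pow_zero, one_apply]
      simp_rw [← ENNReal.tsum_mul_right, eq_comm (a := b)]
      rw [← Summable.tsum_finsetSum fun _ _ => ENNReal.summable]
      congr 1
    have h2 : ∀ a ∈ Finset.univ, N a * ρ.prob a b ≠ ∞ := fun a _ =>
      ENNReal.mul_ne_top (hN a) (ρ.prob_ne_top a b)
    conv_lhs => rw [h1]
    rw [ENNReal.toReal_add (by split_ifs <;> simp) (ENNReal.sum_ne_top.2 h2),
      ENNReal.toReal_sum h2]
    simp_rw [ENNReal.toReal_mul]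
    congr 1
    split_ifs <;> simp
  have hedge : ∀ a b, HasSum (fun τ : G.Traj u =>
      (ρ.trajProb τ).toReal * (τ.passages a b).toReal) ((N a).toReal * (ρ.prob a b).toReal) := by
    intro a b
    have h1 : ∑' τ : G.Traj u, ρ.trajProb τ * τ.passages a b = N a * ρ.prob a b := by
      refine (tsum_traj_passages ρ.mat ρ.prob_of_not_adj u a b).trans ?_
      rw [ρ.tsum_mat_pow_sink hρ, mul_one]
      rfl
    have h2 : ∑' τ : G.Traj u, ρ.trajProb τ * τ.passages a b ≠ ∞ := by
      rw [h1]
      exact ENNReal.mul_ne_top (hN a) (ρ.prob_ne_top a b)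
    have h3 := ENNReal.hasSum_toReal h2
    rw [← ENNReal.tsum_toReal_eq (ENNReal.ne_top_of_tsum_ne_top h2), h1] at h3
    simpa only [ENNReal.toReal_mul] using h3
  have h1 : HasSum (fun τ : G.Traj u => ∑ a, ∑ b, (ρ.trajProb τ).toReal * (τ.passages a b).toReal
      * (r a b + 1 * ρ.entropy a))
      (∑ a, ∑ b, (N a).toReal * (ρ.prob a b).toReal * (r a b + 1 * ρ.entropy a)) :=
    hasSum_sum fun a _ => hasSum_sum fun b _ => (hedge a b).mul_right _
  have h2 : ∑ a, ∑ b, (N a).toReal * (ρ.prob a b).toReal * (r a b + 1 * ρ.entropy a) = φ u := by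
    have h3 : ∀ a, ∑ b, (N a).toReal * (ρ.prob a b).toReal * (r a b + 1 * ρ.entropy a)
        = (N a).toReal * φ a - ∑ b, (N a).toReal * (ρ.prob a b).toReal * φ b := by
      intro a
      by_cases ha : a = G.sink
      · subst ha
        simp [ρ.prob_sink, hφ]
      · simp_rw [mul_assoc, ← Finset.mul_sum]
        rw [step_eq hρ hr ha, klGap_self, sub_zero, mul_sub]
    rw [Finset.sum_congr rfl fun a _ => h3 a, Finset.sum_sub_distrib, Finset.sum_comm]
    simp_rw [← Finset.sum_mul]
    rw [← Finset.sum_sub_distrib]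
    simp_rw [← sub_mul]
    -- The Green function minus its image under one step is the point mass at `u`.
    have h4 : ∀ b, (N b).toReal - ∑ a, (N a).toReal * (ρ.prob a b).toReal
        = if b = u then 1 else 0 := fun b => by rw [hNrec b, add_sub_cancel_right]
    simp [h4]
  rw [h2] at h1
  convert h1 using 2 with τ
  rw [trajReturn, τ.sum_eq_sum_passages fun a b => r a b + 1 * ρ.entropy a]
  simp_rw [Finset.mul_sum, mul_assoc]

end Value

lemma totalReward_pos {R : S → ℝ} (hR : ∀ x, G.Adj x G.sink → 0 < R x) : 0 < G.totalReward R := by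
  classical
  obtain h | ⟨x, -, hx⟩ := Relation.ReflTransGen.cases_tail (G.reach_to_sink G.init)
  · exact absurd h.symm G.init_ne_sink
  · refine Finset.sum_pos' (fun y _ => ?_) ⟨x, Finset.mem_univ x, ?_⟩
    · split_ifs with h
      exacts [(hR y h).le, le_rfl]
    · rw [if_pos hx]
      exact hR x hx

/-! ### The log-flow as potential -/

namespace BackwardPolicy

open scoped Classical in
/-- The logarithm of the state flow, with value `0` at the sink. -/
noncomputable def logFlow (PB : G.BackwardPolicy) (R : S → ℝ) (s : S) : ℝ :=
  if s = G.sink then 0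
  else Real.log (PB.stateFlow (ENNReal.ofReal (G.totalReward R)) s).toReal

variable {PB : G.BackwardPolicy} {R : S → ℝ}

lemma logFlow_sink : PB.logFlow R G.sink = 0 := if_pos rfl

lemma logFlow_of_ne {s : S} (hs : s ≠ G.sink) :
    PB.logFlow R s = Real.log (PB.stateFlow (ENNReal.ofReal (G.totalReward R)) s).toReal :=
  if_neg hs

variable (hPB : ∀ s s', G.Adj s s' → 0 < PB.prob s s')
  (hR : ∀ x, G.Adj x G.sink → 0 < R x)

include hPB hR

lemma logFlow_eq {s : S} (hs : s ≠ G.sink) :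
    PB.logFlow R s = Real.log (G.totalReward R) + Real.log (PB.visits s).toReal := by
  have hZ := totalReward_pos hR
  rw [logFlow_of_ne hs, PB.stateFlow_eq hPB _ hs, ENNReal.toReal_mul, ENNReal.toReal_ofReal hZ.le,
    Real.log_mul hZ.ne'
      (ENNReal.toReal_pos (PB.visits_ne_zero hPB s) (PB.visits_ne_top hPB s)).ne']

lemma coe_logFlow {s : S} (hs : s ≠ G.sink) : (PB.logFlow R s : EReal)
    = ENNReal.log (PB.stateFlow (ENNReal.ofReal (G.totalReward R)) s) := by
  rw [logFlow_of_ne hs, PB.stateFlow_eq hPB _ hs, ENNReal.log_pos_real]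
  · exact mul_ne_zero (ENNReal.ofReal_pos.2 (totalReward_pos hR)).ne' (PB.visits_ne_zero hPB s)
  · exact ENNReal.mul_ne_top ENNReal.ofReal_ne_top (PB.visits_ne_top hPB s)

variable (hmatch : PB.RewardMatching R)

include hmatch

lemma toReal_prob_sink {x : S} (hx : G.Adj x G.sink) :
    (PB.prob x G.sink).toReal = R x / G.totalReward R := by
  rw [PB.prob_sink_of_rewardMatching hPB hmatch hx,
    ENNReal.toReal_ofReal (div_nonneg (hR x hx).le (totalReward_pos hR).le)]

/-- The rewards of the induced MDP are differences of log-flows plus the log-probabilities of the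
forward policy. -/
lemma mdpReward_eq (a b : S) (hab : G.Adj a b) : mdpReward PB R a b
    = PB.logFlow R a + Real.log ((PB.forward hPB).prob a b).toReal - PB.logFlow R b := by
  have hZ := totalReward_pos hR
  have hv : ∀ s, (PB.visits s).toReal ≠ 0 := fun s =>
    (ENNReal.toReal_pos (PB.visits_ne_zero hPB s) (PB.visits_ne_top hPB s)).ne'
  have hp : (PB.prob a b).toReal ≠ 0 :=
    (ENNReal.toReal_pos (hPB a b hab).ne' (PB.prob_ne_top a b)).ne'
  rw [forward_prob, ENNReal.toReal_div, ENNReal.toReal_mul,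
    Real.log_div (mul_ne_zero hp (hv b)) (hv a), Real.log_mul hp (hv b),
    logFlow_eq hPB hR (G.ne_sink_of_adj hab), mdpReward]
  by_cases hb : b = G.sink
  · subst hb
    -- On a terminating edge, `log P_B` is `log R - log Z`, and the `log Z` cancels against the
    -- log-flow of `a`. This is why the potential at the sink must be `0`.
    rw [if_pos rfl, logFlow_sink, visits_sink, toReal_prob_sink hPB hR hmatch hab,
      Real.log_div (hR a hab).ne' hZ.ne', ENNReal.toReal_one, Real.log_one]
    ring
  · rw [if_neg hb, logFlow_eq hPB hR hb]
    ring

lemma mdpReward_add_logFlow {a b : S} (hab : G.Adj a b) :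
    ((mdpReward PB R a b : ℝ) : EReal) + (PB.logFlow R b : EReal)
      = ENNReal.log (PB.edgeFlow (ENNReal.ofReal (G.totalReward R)) a b) := by
  have hZ := totalReward_pos hR
  have hv := ENNReal.toReal_pos (PB.visits_ne_zero hPB b) (PB.visits_ne_top hPB b)
  have hp := ENNReal.toReal_pos (hPB a b hab).ne' (PB.prob_ne_top a b)
  have h : (PB.edgeFlow (ENNReal.ofReal (G.totalReward R)) a b).toReal
      = G.totalReward R * ((PB.prob a b).toReal * (PB.visits b).toReal) := by
    rw [PB.edgeFlow_eq hPB, ENNReal.toReal_mul, ENNReal.toReal_mul, ENNReal.toReal_ofReal hZ.le]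
  rw [ENNReal.log_pos_real' (by rw [h]; positivity), h, ← EReal.coe_add, EReal.coe_eq_coe_iff,
    Real.log_mul hZ.ne' (mul_pos hp hv).ne', Real.log_mul hp.ne' hv.ne', mdpReward]
  by_cases hb : b = G.sink
  · subst hb
    rw [if_pos rfl, logFlow_sink, visits_sink, toReal_prob_sink hPB hR hmatch hab,
      Real.log_div (hR a hab).ne' hZ.ne', ENNReal.toReal_one, Real.log_one]
    ring
  · rw [if_neg hb, logFlow_eq hPB hR hb]
    ring

end BackwardPolicy

end FlowGraph

theorem mainTheorem1 {S : Type*} [Fintype S] (G : FlowGraph S)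
    (R : S → ℝ) (hR : ∀ x, G.Adj x G.sink → 0 < R x)
    (PB : G.BackwardPolicy) (hPB : ∀ s s', G.Adj s s' → 0 < PB.prob s s')
    (hmatch : PB.RewardMatching R) :
    ∃ PF : G.ForwardPolicy,
      -- `PF` is the unique forward policy corresponding to `PB`
      (FlowGraph.Corresponds PF PB ∧
        ∀ P : G.ForwardPolicy, FlowGraph.Corresponds P PB → P = PF) ∧
      -- `PF` is the optimal policy for `λ = 1`, and the only one
      (∀ π : G.ForwardPolicy, π.IsOptimal (FlowGraph.mdpReward PB R) 1 ↔ π = PF) ∧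
      -- under `PF` trajectories are almost surely finite and the expected return is `log F(s)`
      (∀ s, s ≠ G.sink →
        (∑' τ : G.Traj s, PF.trajProb τ) = 1 ∧
        HasSum (fun τ : G.Traj s =>
            (PF.trajProb τ).toReal * PF.trajReturn (FlowGraph.mdpReward PB R) 1 τ)
          (Real.log (PB.stateFlow (ENNReal.ofReal (G.totalReward R)) s).toReal)) ∧
      -- the optimal value is that of `PF`, and equals `log F(s)`
      (∀ s, s ≠ G.sink →
        G.optValue (FlowGraph.mdpReward PB R) 1 s = PF.value (FlowGraph.mdpReward PB R) 1 s ∧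
        G.optValue (FlowGraph.mdpReward PB R) 1 s
          = ENNReal.log (PB.stateFlow (ENNReal.ofReal (G.totalReward R)) s)) ∧
      -- the optimal Q-value is that of `PF`, and equals `log F(s → s')`
      (∀ s s', G.Adj s s' →
        G.optQValue (FlowGraph.mdpReward PB R) 1 s s'
          = PF.qValue (FlowGraph.mdpReward PB R) 1 s s' ∧
        G.optQValue (FlowGraph.mdpReward PB R) 1 s s'
          = ENNReal.log (PB.edgeFlow (ENNReal.ofReal (G.totalReward R)) s s')) := by
  have hρ := PB.forward_prob_ne_zero hPB
  have hφ := FlowGraph.BackwardPolicy.logFlow_sink (PB := PB) (R := R)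
  have hr := FlowGraph.BackwardPolicy.mdpReward_eq hPB hR hmatch
  have hopt := FlowGraph.optValue_eq hρ hφ hr
  have hval := FlowGraph.ForwardPolicy.value_self hρ hφ hr
  refine ⟨PB.forward hPB, ⟨PB.corresponds_forward hPB,
    fun P hP => PB.eq_forward_of_corresponds hPB hP⟩,
    FlowGraph.ForwardPolicy.isOptimal_iff hρ hφ hr, fun s hs => ⟨?_, ?_⟩,
    fun s hs => ⟨?_, ?_⟩, fun s s' h => ⟨?_, ?_⟩⟩
  · exact (PB.forward hPB).tsum_trajProb hρ hs
  · rw [← FlowGraph.BackwardPolicy.logFlow_of_ne hs]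
    exact FlowGraph.ForwardPolicy.hasSum_trajReturn hρ hφ hr s
  · rw [hopt, hval]
  · rw [hopt, FlowGraph.BackwardPolicy.coe_logFlow hPB hR hs]
  · rw [FlowGraph.optQValue, FlowGraph.ForwardPolicy.qValue, hopt, hval]
  · rw [FlowGraph.optQValue, hopt,
      FlowGraph.BackwardPolicy.mdpReward_add_logFlow hPB hR hmatch h]
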